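/- **Setting.** Let $n\ge 1$. An instance consists of $n$ men $M$, $n$ women $W$, and for every agent $i$ a strict total order $\succ_i$ (the true preference) on the agents of the other side. A matching is a bijection $\mu$ between $M$ and $W$; a pair $(m,w)\in M\times W$ blocks $\mu$ if $w\succ_m\mu(m)$ and $m\succ_w\mu(w)$. Let $\mathrm{NSP}(\mu)$ be the number of pairs in $M\times W$ that do not block $\mu$ (with respect to the true preferences). Let $P\subseteq M\times W$ be a set of strategic pairs, let $P_m=\{m : (m,w)\in P \text{ for some } w\}$, and let $A$ be any set of men with $P_m\subseteq A\subseteq M$ (the men who are free to choose a report; $A=P_m$ and $A=M$ are the extreme cases). A strategy profile is a list $\mathbf p=(\mathbf p_m)_{m\in M}$ of strict total orders on $W$ with $\mathbf p_m=\succ_m$ for $m\notin A$; the women report truthfully. Let $\mathrm{DA}(\mathbf p)$ be the matching returned by the men-proposing deferred acceptance algorithm on the reports. The profile $\mathbf p$ is a (pure) Nash equilibrium of the accomplice game if there are no pair $(m,w)\in P$ and report $\mathbf p'_m$ such that $\mu'=\mathrm{DA}(\mathbf p_{-m},\mathbf p'_m)$ and $\mu=\mathrm{DA}(\mathbf p)$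 satisfy $\mu'(w)\succ_w\mu(w)$ and $\mu'(m)\succeq_m\mu(m)$. Let $\mathrm{NE}$ be the set of matchings $\mathrm{DA}(\mathbf p)$ of Nash equilibria $\mathbf p$, and put $$\mathrm{PoA}=\frac{\max_{\mu}\mathrm{NSP}(\mu)}{\min_{\mu\in\mathrm{NE}}\mathrm{NSP}(\mu)},\qquad \mathrm{PoS}=\frac{\max_{\mu}\mathrm{NSP}(\mu)}{\max_{\mu\in\mathrm{NE}}\mathrm{NSP}(\mu)},$$ where $\max_\mu$ runs over all matchings. **Theorem.** For every instance and all $P$, $A$ as above, $\mathrm{NE}\neq\emptyset$, $\max_\mu\mathrm{NSP}(\mu)=n^2$, $\mathrm{PoS}=1$, and, if $P\ne\emptyset$, $\mathrm{PoA}\le n^2/|P|$. Moreover, the bound on the price of anarchy is attained: for the instance with $n=5$ and preference lists (most preferred first) $$\begin{array}{ll} m_1: w_2,w_1,w_3,w_4,w_5 & w_1: m_1,m_3,m_2,m_4,m_5\\ m_2: w_1,w_2,w_3,w_4,w_5 & w_2: m_2,m_3,m_1,m_4,m_5\\ m_3: w_1,w_2,w_3,w_4,w_5 & w_3: m_3,m_1,m_2,m_4,m_5\\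 m_4: w_4,w_5,w_1,w_2,w_3 & w_4: m_5,m_3,m_1,m_2,m_4\\ m_5: w_5,w_4,w_1,w_2,w_3 & w_5: m_4,m_1,m_2,m_3,m_5 \end{array}$$ and $P=(M\times W)\setminus\{(m_3,w_1),(m_3,w_2)\}$ (so that $P_m=M$), one has $\mathrm{PoA}=5^2/|P|$. -/

import Mathlib

namespace StableMarriage

/-- A preference list: a strict total ordering of the `n` agents of the other side.
`ℓ k` is the agent in position `k`, where position `0` is the most preferred one. -/
abbrev Pref (n : ℕ) := Equiv.Perm (Fin n)

/-- `a` is strictly preferred to `b` in the list `ℓ`. -/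
def Pref.Prefers {n : ℕ} (ℓ : Pref n) (a b : Fin n) : Prop := ℓ.symm a < ℓ.symm b

/-- `a` is weakly preferred to `b` in the list `ℓ`. -/
def Pref.WeaklyPrefers {n : ℕ} (ℓ : Pref n) (a b : Fin n) : Prop := ℓ.symm a ≤ ℓ.symm b

instance {n : ℕ} (ℓ : Pref n) (a b : Fin n) : Decidable (ℓ.Prefers a b) :=
  inferInstanceAs (Decidable (ℓ.symm a < ℓ.symm b))

instance {n : ℕ} (ℓ : Pref n) (a b : Fin n) : Decidable (ℓ.WeaklyPrefers a b) :=
  inferInstanceAs (Decidable (ℓ.symm a ≤ ℓ.symm b))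

/-- A stable matching instance with men `Fin n`, women `Fin n` and a preference list for
every agent. -/
structure Market (n : ℕ) where
  men : Fin n → Pref n
  women : Fin n → Pref n

/-- A matching: `μ m` is the wife of the man `m`, and `μ.symm w` the husband of the woman `w`. -/
abbrev Matching (n : ℕ) := Equiv.Perm (Fin n)

namespace Market

variable {n : ℕ}

/-- The man `m` and the woman `w` prefer each other to their partners in `μ`. -/
def Blocks (I : Market n) (μ : Matching n) (m w : Fin n) : Prop :=
  (I.men m).Prefers w (μ m) ∧ (I.women w).Prefers m (μ.symm w)

instance (I : Market n) (μ : Matching n) (m w : Fin n) : Decidable (I.Blocks μ m w) :=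
  inferInstanceAs (Decidable (_ ∧ _))

/-- The number of stable (non-blocking) man-woman pairs of `μ`. -/
def nsp (I : Market n) (μ : Matching n) : ℕ :=
  (Finset.univ.filter fun x : Fin n × Fin n => ¬ I.Blocks μ x.1 x.2).card

/-! ### Men-proposing deferred acceptance

The state of the algorithm is the set `R` of pairs `(m, w)` such that `w` has rejected `m`. -/

/-- The positions in the list of `m` of the women who have not rejected him yet. -/
def open_positions (I : Market n) (R : Finset (Fin n × Fin n)) (m : Fin n) : Finset (Fin n) :=
  Finset.univ.filter fun k => (m, I.men m k) ∉ R

/-- The favourite woman of `m` among those who have not rejected him yet, if there is one.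
(A man who is tentatively accepted keeps proposing to the woman who holds him.) -/
def proposal (I : Market n) (R : Finset (Fin n × Fin n)) (m : Fin n) : Option (Fin n) :=
  if h : (I.open_positions R m).Nonempty then
    some (I.men m ((I.open_positions R m).min' h))
  else none

/-- One round: each man proposes, and each woman rejects all her proposers
except the one she likes best. -/
def daStep (I : Market n) (R : Finset (Fin n × Fin n)) : Finset (Fin n × Fin n) :=
  R ∪ Finset.univ.filter fun x : Fin n × Fin n =>
    I.proposal R x.1 = some x.2 ∧
      ∃ m', I.proposal R m' = some x.2 ∧ (I.women x.2).Prefers m' x.1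

/-- The rejections at the end of the algorithm. There are at most `n * n` of them, and each round
before termination adds one, so `n * n` rounds suffice (`daStep_finalRejections`). -/
def finalRejections (I : Market n) : Finset (Fin n × Fin n) :=
  (I.daStep)^[n * n] ∅

theorem daStep_finalRejections (I : Market n) :
    I.daStep I.finalRejections = I.finalRejections := by
  have key : ∀ k, I.daStep ((I.daStep)^[k] ∅) = (I.daStep)^[k] ∅ ∨
      k ≤ ((I.daStep)^[k] ∅).card := by
    intro k
    induction k with
    | zero => right; simp
    | succ k ih =>
      rw [Function.iterate_succ_apply']
      by_cases hfix : I.daStep ((I.daStep)^[k] ∅) = (I.daStep)^[k] ∅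
      · left; rw [hfix, hfix]
      · right
        have h1 := ih.resolve_left hfix
        have hlt : ((I.daStep)^[k] ∅) ⊂ I.daStep ((I.daStep)^[k] ∅) :=
          lt_of_le_of_ne Finset.subset_union_left (Ne.symm hfix)
        have := Finset.card_lt_card hlt
        omega
  rcases key (n * n) with h | h
  · exact h
  · have huniv : (I.daStep)^[n * n] ∅ = (Finset.univ : Finset (Fin n × Fin n)) := by
      apply Finset.eq_univ_of_card
      apply le_antisymm (Finset.card_le_univ _)
      simpa using h
    unfold finalRejections
    rw [huniv]
    exact Finset.eq_univ_of_forall fun x => Finset.mem_union_left _ (Finset.mem_univ x)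

theorem proposal_notMem (I : Market n) {R : Finset (Fin n × Fin n)} {m w : Fin n}
    (h : I.proposal R m = some w) : (m, w) ∉ R := by
  unfold proposal at h
  split_ifs at h with hne
  have hmem := Finset.min'_mem _ hne
  simp only [Option.some.injEq] at h
  rw [h.symm]
  exact (Finset.mem_filter.mp hmem).2

theorem proposal_mono (I : Market n) {R R' : Finset (Fin n × Fin n)} {m w : Fin n}
    (hR : R ⊆ R') (h : I.proposal R m = some w) (hw : (m, w) ∉ R') :
    I.proposal R' m = some w := by
  unfold proposal at h
  split_ifs at h with hne
  simp only [Option.some.injEq] at h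
  subst h
  have hmem : (I.open_positions R m).min' hne ∈ I.open_positions R' m :=
    Finset.mem_filter.mpr ⟨Finset.mem_univ _, hw⟩
  have hne' : (I.open_positions R' m).Nonempty := ⟨_, hmem⟩
  unfold proposal
  rw [dif_pos hne']
  have hsub : I.open_positions R' m ⊆ I.open_positions R m := fun k hk =>
    Finset.mem_filter.mpr ⟨Finset.mem_univ _, fun hh => (Finset.mem_filter.mp hk).2 (hR hh)⟩
  have : (I.open_positions R' m).min' hne' = (I.open_positions R m).min' hne :=
    le_antisymm (Finset.min'_le _ _ hmem) (Finset.min'_subset hne' hsub)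
  rw [this]

/-- A woman who has rejected a man always has a proposer. -/
theorem exists_proposal_of_mem_iterate (I : Market n) (k : ℕ) :
    ∀ m w, (m, w) ∈ (I.daStep)^[k] ∅ → ∃ m', I.proposal ((I.daStep)^[k] ∅) m' = some w := by
  induction k with
  | zero => intro m w h; simp at h
  | succ k ih =>
    intro m w h
    rw [Function.iterate_succ_apply'] at h ⊢
    generalize (I.daStep)^[k] ∅ = R at ih h
    have hex : ∃ m', I.proposal R m' = some w := by
      rcases Finset.mem_union.mp h with h | h
      · exact ih m w h
      · exact ⟨m, (Finset.mem_filter.mp h).2.1⟩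
    let S : Finset (Fin n) := Finset.univ.filter fun m' => I.proposal R m' = some w
    have hS : S.Nonempty := by
      obtain ⟨m', hm'⟩ := hex
      exact ⟨m', Finset.mem_filter.mpr ⟨Finset.mem_univ _, hm'⟩⟩
    obtain ⟨b, hbS, hb⟩ := Finset.exists_min_image S (fun m' => (I.women w).symm m') hS
    have hbp : I.proposal R b = some w := (Finset.mem_filter.mp hbS).2
    refine ⟨b, I.proposal_mono Finset.subset_union_left hbp ?_⟩
    intro hmem
    rcases Finset.mem_union.mp hmem with hmem | hmem
    · exact I.proposal_notMem hbp hmem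
    · obtain ⟨-, -, m', hm', hlt⟩ := Finset.mem_filter.mp hmem
      exact absurd hlt (not_lt.mpr (hb m' (Finset.mem_filter.mpr ⟨Finset.mem_univ _, hm'⟩)))

theorem proposal_injective (I : Market n) {m m' w : Fin n}
    (h : I.proposal I.finalRejections m = some w)
    (h' : I.proposal I.finalRejections m' = some w) : m = m' := by
  have aux : ∀ {a b : Fin n}, I.proposal I.finalRejections a = some w →
      I.proposal I.finalRejections b = some w → ¬ (I.women w).Prefers b a := by
    intro a b ha hb hlt
    have : (a, w) ∈ I.daStep I.finalRejections :=
      Finset.mem_union_right _ (Finset.mem_filter.mpr ⟨Finset.mem_univ _, ha, b, hb, hlt⟩)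
    rw [daStep_finalRejections] at this
    exact I.proposal_notMem ha this
  exact (I.women w).symm.injective
    (le_antisymm (not_lt.mp (aux h h')) (not_lt.mp (aux h' h)))

theorem proposal_isSome (I : Market n) (m : Fin n) :
    (I.proposal I.finalRejections m).isSome := by
  by_contra hnone
  have hall : ∀ w, (m, w) ∈ I.finalRejections := by
    intro w
    by_contra hw
    apply hnone
    have hne : (I.open_positions I.finalRejections m).Nonempty :=
      ⟨(I.men m).symm w, Finset.mem_filter.mpr ⟨Finset.mem_univ _, by simpa using hw⟩⟩
    unfold proposal
    rw [dif_pos hne]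
    rfl
  choose f hf using fun w => I.exists_proposal_of_mem_iterate (n * n) m w (hall w)
  have hinj : Function.Injective f := by
    intro w w' hww
    have h1 := hf w
    rw [hww, hf w'] at h1
    exact (Option.some.inj h1).symm
  obtain ⟨w, hw⟩ := (Finite.injective_iff_surjective.mp hinj) m
  apply hnone
  have := hf w
  rw [hw] at this
  unfold finalRejections
  rw [this]
  rfl

/-- The wife of `m` at the end of the algorithm: the woman he proposes to in the last round. -/
def daWife (I : Market n) (m : Fin n) : Fin n :=
  (I.proposal I.finalRejections m).get (I.proposal_isSome m)

theorem daWife_bijective (I : Market n) : Function.Bijective I.daWife := by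
  apply Finite.injective_iff_bijective.mp
  intro a b hab
  refine I.proposal_injective (w := I.daWife a) (by simp [daWife]) ?_
  rw [hab]
  simp [daWife]

/-- The outcome of the men-proposing deferred acceptance algorithm. -/
noncomputable def da (I : Market n) : Matching n :=
  Equiv.ofBijective I.daWife I.daWife_bijective

/-! ### The accomplice manipulation game -/

/-- The outcome of deferred acceptance if the men report `p` and the women report truthfully. -/
noncomputable def outcome (I : Market n) (p : Fin n → Pref n) : Matching n :=
  (Market.mk p I.women).da

/-- At the profile `p`, the misreport `q` of `m` is an accomplice manipulation by `(m, w)`: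
it strictly improves the partner of `w` and does not worsen the partner of `m`, with partners
compared according to the true preferences. -/
def IsAccompliceManipulation (I : Market n) (p : Fin n → Pref n) (m w : Fin n) (q : Pref n) :
    Prop :=
  (I.women w).Prefers ((I.outcome (Function.update p m q)).symm w) ((I.outcome p).symm w) ∧
    (I.men m).WeaklyPrefers (I.outcome (Function.update p m q) m) (I.outcome p m)

/-- The men who occur in a strategic pair. -/
def strategicMen (P : Finset (Fin n × Fin n)) : Finset (Fin n) := P.image Prod.fst

/-- A strategy profile: a list of reports of all men, in which the men outside `A` (the men who
are not free to choose their report) report truthfully. -/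
def IsStrategyProfile (I : Market n) (A : Finset (Fin n)) (p : Fin n → Pref n) : Prop :=
  ∀ m ∉ A, p m = I.men m

/-- A (pure) Nash equilibrium of the accomplice manipulation game with strategic pairs `P`. -/
def IsNash (I : Market n) (P : Finset (Fin n × Fin n)) (A : Finset (Fin n))
    (p : Fin n → Pref n) : Prop :=
  I.IsStrategyProfile A p ∧
    ∀ m w, (m, w) ∈ P → ¬ ∃ q : Pref n, I.IsAccompliceManipulation p m w q

/-- The matchings that are outcomes of Nash equilibria. -/
def nashMatchings (I : Market n) (P : Finset (Fin n × Fin n)) (A : Finset (Fin n)) :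
    Set (Matching n) :=
  {μ | ∃ p, I.IsNash P A p ∧ I.outcome p = μ}

/-- The largest number of stable pairs in any matching. -/
noncomputable def maxNsp (I : Market n) : ℕ := sSup (Set.range I.nsp)

/-- The price of anarchy. -/
noncomputable def priceOfAnarchy (I : Market n) (P : Finset (Fin n × Fin n))
    (A : Finset (Fin n)) : ℚ :=
  (I.maxNsp : ℚ) / (sInf (I.nsp '' I.nashMatchings P A) : ℕ)

/-- The price of stability. -/
noncomputable def priceOfStability (I : Market n) (P : Finset (Fin n × Fin n))
    (A : Finset (Fin n)) : ℚ :=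
  (I.maxNsp : ℚ) / (sSup (I.nsp '' I.nashMatchings P A) : ℕ)

end Market

/-! ### The five-by-five instance (agents are numbered from `0`) -/

/-- The preference list with entries `f 0, f 1, …`; `g` gives the position of each agent. -/
def mkPref {n : ℕ} (f g : Fin n → Fin n) (h₁ : ∀ x, g (f x) = x) (h₂ : ∀ x, f (g x) = x) :
    Pref n := ⟨f, g, h₁, h₂⟩

def fiveMen : Fin 5 → Pref 5 := ![
  mkPref ![1, 0, 2, 3, 4] ![1, 0, 2, 3, 4] (by decide) (by decide),
  mkPref ![0, 1, 2, 3, 4] ![0, 1, 2, 3, 4] (by decide) (by decide),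
  mkPref ![0, 1, 2, 3, 4] ![0, 1, 2, 3, 4] (by decide) (by decide),
  mkPref ![3, 4, 0, 1, 2] ![2, 3, 4, 0, 1] (by decide) (by decide),
  mkPref ![4, 3, 0, 1, 2] ![2, 3, 4, 1, 0] (by decide) (by decide)]

def fiveWomen : Fin 5 → Pref 5 := ![
  mkPref ![0, 2, 1, 3, 4] ![0, 2, 1, 3, 4] (by decide) (by decide),
  mkPref ![1, 2, 0, 3, 4] ![2, 0, 1, 3, 4] (by decide) (by decide),
  mkPref ![2, 0, 1, 3, 4] ![1, 2, 0, 3, 4] (by decide) (by decide),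
  mkPref ![4, 2, 0, 1, 3] ![2, 3, 1, 4, 0] (by decide) (by decide),
  mkPref ![3, 0, 1, 2, 4] ![1, 2, 3, 0, 4] (by decide) (by decide)]

def fiveMarket : Market 5 := ⟨fiveMen, fiveWomen⟩

/-- All pairs except the third man with the first and with the second woman. -/
def fivePairs : Finset (Fin 5 × Fin 5) := Finset.univ \ {(2, 0), (2, 1)}

end StableMarriage

namespace StableMarriage

/-! ### Preference lists -/

/-! Deferred acceptance is man-optimal and woman-pessimal among stable matchings and strategy-proof
for the men; all of this follows from the blocking lemma `exists_blocks_of_prefers_da`.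

Price of stability: consider the profiles that are truthful below their outcome (`IsTruthfulBelow`).
Truth-telling is one, and their outcomes are stable for the true preferences. By
`IsTruthfulBelow.exists_improvement`, a profitable deviation can be replaced by one that stays in
this class and makes no woman worse off and one better off. Hence a profile minimizing the sum of
the women's ranks of their husbands is an equilibrium with a stable outcome, in which all n² pairs
are non-blocking.

Price of anarchy: if a strategic pair (m, w) blocked an equilibrium outcome, m could move w to the
top of his report. Stability then gives w at least m, and strategy-proofness leaves m with w or his
old wife. So every pair of P is non-blocking.

Tightness: in the example the men report a matching as their first choices; it is an equilibrium
outcome, blocked only by the two pairs outside P. -/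

theorem Pref.not_prefers {n : ℕ} {ℓ : Pref n} {a b : Fin n} :
    ¬ ℓ.Prefers a b ↔ ℓ.WeaklyPrefers b a := not_lt

theorem Pref.WeaklyPrefers.lt_of_ne {n : ℕ} {ℓ : Pref n} {a b : Fin n}
    (h : ℓ.WeaklyPrefers a b) (hne : a ≠ b) : ℓ.Prefers a b :=
  lt_of_le_of_ne h fun h' => hne (ℓ.symm.injective h')

theorem Pref.WeaklyPrefers.antisymm {n : ℕ} {ℓ : Pref n} {a b : Fin n}
    (h : ℓ.WeaklyPrefers a b) (h' : ℓ.WeaklyPrefers b a) : a = b :=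
  ℓ.symm.injective (le_antisymm h h')

theorem Pref.Prefers.ne {n : ℕ} {ℓ : Pref n} {a b : Fin n} (h : ℓ.Prefers a b) : a ≠ b := by
  rintro rfl
  exact lt_irrefl _ h

/-- Every injective ranking is induced by a preference list. -/
theorem Pref.exists_of_key {n : ℕ} (f : Fin n → ℕ) (hf : Function.Injective f) :
    ∃ ℓ : Pref n, ∀ a b, ℓ.Prefers a b ↔ f a < f b := by
  have hmono : StrictMono (f ∘ Tuple.sort f) :=
    (Tuple.monotone_sort f).strictMono_of_injective (hf.comp (Tuple.sort f).injective)
  refine ⟨Tuple.sort f, fun a b => ?_⟩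
  have := hmono.lt_iff_lt (a := (Tuple.sort f).symm a) (b := (Tuple.sort f).symm b)
  simpa [Pref.Prefers] using this.symm

/-- The agents of a set can be moved to the top of a list, all else remaining in order. -/
theorem Pref.exists_promote {n : ℕ} (ℓ : Pref n) (U : Set (Fin n)) :
    ∃ ℓ' : Pref n, ∀ a b, ℓ'.Prefers a b ↔
      (a ∈ U ∧ b ∉ U) ∨ ((a ∈ U ↔ b ∈ U) ∧ ℓ.Prefers a b) := by
  classical
  -- Old positions are below n, so adding n sends everyone outside U behind all of U.
  let f : Fin n → ℕ := fun a => if a ∈ U then (ℓ.symm a : ℕ) else n + ℓ.symm a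
  have hf : Function.Injective f := by
    intro a b hab
    apply ℓ.symm.injective
    apply Fin.ext
    have ha := (ℓ.symm a).isLt
    have hb := (ℓ.symm b).isLt
    simp only [f] at hab
    split_ifs at hab <;> omega
  obtain ⟨ℓ', h⟩ := Pref.exists_of_key f hf
  refine ⟨ℓ', fun a b => (h a b).trans ?_⟩
  have ha := (ℓ.symm a).isLt
  have hb := (ℓ.symm b).isLt
  simp only [f, Pref.Prefers, Fin.lt_def]
  by_cases h1 : a ∈ U <;> by_cases h2 : b ∈ U <;> simp [h1, h2] <;> omega

namespace Market

variable {n : ℕ}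

/-! ### Properties of deferred acceptance -/

/-- The rejections after `k` rounds. -/
def rejections (I : Market n) (k : ℕ) : Finset (Fin n × Fin n) := (I.daStep)^[k] ∅

theorem rejections_succ (I : Market n) (k : ℕ) :
    I.rejections (k + 1) = I.daStep (I.rejections k) :=
  Function.iterate_succ_apply' _ _ _

theorem rejections_subset_final (I : Market n) (k : ℕ) :
    I.rejections k ⊆ I.finalRejections := by
  have mono : Monotone I.rejections := monotone_nat_of_le_succ fun k => by
    rw [rejections_succ]
    exact Finset.subset_union_left
  have stable : ∀ j, I.rejections (n * n + j) = I.finalRejections := by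
    intro j
    induction j with
    | zero => rfl
    | succ j ih => rw [← Nat.add_assoc, rejections_succ, ih, daStep_finalRejections]
  rw [← stable k]
  exact mono (Nat.le_add_left _ _)

theorem proposal_da (I : Market n) (m : Fin n) :
    I.proposal I.finalRejections m = some (I.da m) := by
  simp [da, daWife]

theorem proposal_weaklyPrefers (I : Market n) {R : Finset (Fin n × Fin n)} {m w v : Fin n}
    (h : I.proposal R m = some w) (hv : (m, v) ∉ R) : (I.men m).WeaklyPrefers w v := by
  unfold proposal at h
  split_ifs at h with hne
  simp only [Option.some.injEq] at h
  subst h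
  have : (I.men m).symm v ∈ I.open_positions R m :=
    Finset.mem_filter.mpr ⟨Finset.mem_univ _, by simpa using hv⟩
  simpa [Pref.WeaklyPrefers] using Finset.min'_le _ _ this

theorem mem_of_proposal_of_prefers (I : Market n) {R : Finset (Fin n × Fin n)} {m w v : Fin n}
    (h : I.proposal R m = some w) (hv : (I.men m).Prefers v w) : (m, v) ∈ R := by
  by_contra hmem
  exact not_lt.mpr (I.proposal_weaklyPrefers h hmem) hv

/-- Among the proposers of a woman there is a best one, whom she does not reject. -/
theorem exists_best_proposer (I : Market n) {R : Finset (Fin n × Fin n)} {m w : Fin n}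
    (h : I.proposal R m = some w) :
    ∃ b, I.proposal R b = some w ∧ I.proposal (I.daStep R) b = some w ∧
      (I.women w).WeaklyPrefers b m := by
  let S : Finset (Fin n) := Finset.univ.filter fun m' => I.proposal R m' = some w
  have hm : m ∈ S := Finset.mem_filter.mpr ⟨Finset.mem_univ _, h⟩
  obtain ⟨b, hbS, hb⟩ := Finset.exists_min_image S (fun m' => (I.women w).symm m') ⟨m, hm⟩
  have hbp : I.proposal R b = some w := (Finset.mem_filter.mp hbS).2
  refine ⟨b, hbp, I.proposal_mono Finset.subset_union_left hbp ?_, hb m hm⟩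
  intro hmem
  rcases Finset.mem_union.mp hmem with hmem | hmem
  · exact I.proposal_notMem hbp hmem
  · obtain ⟨-, -, m', hm', hlt⟩ := Finset.mem_filter.mp hmem
    exact absurd hlt (not_lt.mpr (hb m' (Finset.mem_filter.mpr ⟨Finset.mem_univ _, hm'⟩)))

/-- A woman who has rejected a man by the end of a round holds, during that round and after it,
a man whom she likes better. -/
theorem exists_better_proposer (I : Market n) (k : ℕ) {s w : Fin n}
    (h : (s, w) ∈ I.rejections (k + 1)) :
    ∃ b, I.proposal (I.rejections k) b = some w ∧
      I.proposal (I.rejections (k + 1)) b = some w ∧ (I.women w).Prefers b s := by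
  have step : ∀ k, (s, w) ∈ I.rejections (k + 1) →
      ((s, w) ∈ I.rejections k → ∃ b, I.proposal (I.rejections k) b = some w ∧
        (I.women w).Prefers b s) →
      ∃ b, I.proposal (I.rejections k) b = some w ∧
        I.proposal (I.rejections (k + 1)) b = some w ∧ (I.women w).Prefers b s := by
    intro k hk hold
    rw [rejections_succ] at hk ⊢
    obtain ⟨c, hc, hcs⟩ : ∃ c, I.proposal (I.rejections k) c = some w ∧
        (I.women w).Prefers c s := by
      rcases Finset.mem_union.mp hk with hk | hk
      · exact hold hk
      · obtain ⟨-, -, c, hc, hcs⟩ := Finset.mem_filter.mp hk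
        exact ⟨c, hc, hcs⟩
    obtain ⟨b, hb, hb', hbc⟩ := I.exists_best_proposer hc
    exact ⟨b, hb, hb', lt_of_le_of_lt hbc hcs⟩
  induction k with
  | zero => exact step 0 h fun h0 => by simp [rejections] at h0
  | succ k ih =>
    exact step (k + 1) h fun hk => by
      obtain ⟨b, -, hb, hbs⟩ := ih hk
      exact ⟨b, hb, hbs⟩

/-- A matching without blocking pairs. -/
def IsStable (I : Market n) (μ : Matching n) : Prop := ∀ m w, ¬ I.Blocks μ m w

theorem da_isStable (I : Market n) : I.IsStable I.da := by
  rintro m w ⟨hm, hw⟩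
  -- The state after n * n rounds is final; the extra round only fits the k + 1 of
  -- `exists_better_proposer`.
  have hmem : (m, w) ∈ I.rejections (n * n + 1) := by
    rw [rejections_succ]
    exact Finset.mem_union_left _ (I.mem_of_proposal_of_prefers (I.proposal_da m) hm)
  obtain ⟨b, hb, -, hbm⟩ := I.exists_better_proposer _ hmem
  have hbw : I.da b = w := Option.some.inj ((I.proposal_da b).symm.trans hb)
  rw [← hbw, Equiv.symm_apply_apply, hbw] at hw
  exact lt_asymm hw hbm

/-- The blocking lemma of Gale and Sotomayor: if some man strictly prefers `ν` to the outcome of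
deferred acceptance, then `ν` is blocked by a pair whose man does not. -/
theorem exists_blocks_of_prefers_da (I : Market n) (ν : Matching n) {r : Fin n}
    (hr : (I.men r).Prefers (ν r) (I.da r)) :
    ∃ m w, I.Blocks ν m w ∧ (I.men m).WeaklyPrefers (I.da m) (ν m) := by
  classical
  let R : Finset (Fin n) := Finset.univ.filter fun m => (I.men m).Prefers (ν m) (I.da m)
  have memR : ∀ {m}, m ∈ R ↔ (I.men m).Prefers (ν m) (I.da m) := by simp [R]
  have notMemR : ∀ {m}, m ∉ R → (I.men m).WeaklyPrefers (I.da m) (ν m) := fun h =>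
    Pref.not_prefers.mp fun h' => h (memR.mpr h')
  by_cases hmaps : ∀ m ∈ R, I.da.symm (ν m) ∈ R
  · have himage : R.image (fun m => I.da.symm (ν m)) = R := by
      apply Finset.eq_of_subset_of_card_le
      · intro x hx
        obtain ⟨m, hm, rfl⟩ := Finset.mem_image.mp hx
        exact hmaps m hm
      · exact (Finset.card_image_of_injective R (I.da.symm.injective.comp ν.injective)).ge
    -- The man a is among the last of R to reach his final wife. She has already rejected the man s
    -- of R whom ν gives her, so the man b she held before a came is better than s; b will turn out
    -- to lie outside R.
    obtain ⟨k, ⟨a, haR, ha⟩, hk⟩ : ∃ k,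
        (∃ a ∈ R, I.proposal (I.rejections k) a ≠ some (I.da a)) ∧
          ∀ a ∈ R, I.proposal (I.rejections (k + 1)) a = some (I.da a) := by
      by_contra! hcon
      have hall : ∀ k, ∃ a ∈ R, I.proposal (I.rejections k) a ≠ some (I.da a) := by
        intro k
        induction k with
        | zero =>
          refine ⟨r, memR.mpr hr, fun h => ?_⟩
          simpa [rejections] using I.mem_of_proposal_of_prefers h hr
        | succ k ih => exact hcon k ih
      obtain ⟨a, -, ha⟩ := hall (n * n)
      exact ha (I.proposal_da a)
    obtain ⟨s, hsR, hs⟩ := Finset.mem_image.mp (himage.symm ▸ haR)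
    replace hs : ν s = I.da a := by rw [← hs]; simp
    have hsw : (s, I.da a) ∈ I.rejections (k + 1) :=
      I.mem_of_proposal_of_prefers (hk s hsR) (hs ▸ memR.mp hsR)
    obtain ⟨b, hb, hb', hbs⟩ := I.exists_better_proposer k hsw
    have hba : b ≠ a := by
      rintro rfl
      exact ha hb
    have hbR : b ∉ R := fun hbR =>
      hba (I.da.injective (Option.some.inj ((hk b hbR).symm.trans hb')))
    have hopen : (b, I.da b) ∉ I.rejections k := fun h =>
      I.proposal_notMem (I.proposal_da b) (I.rejections_subset_final k h)
    have hlt : (I.men b).Prefers (I.da a) (I.da b) :=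
      (I.proposal_weaklyPrefers hb hopen).lt_of_ne fun h => hba (I.da.injective h.symm)
    refine ⟨b, I.da a, ⟨lt_of_lt_of_le hlt (notMemR hbR), ?_⟩, notMemR hbR⟩
    rw [← hs, Equiv.symm_apply_apply, hs]
    exact hbs
  · push Not at hmaps
    obtain ⟨a, haR, ha⟩ := hmaps
    have hne : I.da.symm (ν a) ≠ a := fun h => ha (h.symm ▸ haR)
    -- The man a would rather have ν a than his own wife, so stability of `I.da` forces her to
    -- prefer her husband there to a.
    refine ⟨I.da.symm (ν a), ν a, ⟨?_, ?_⟩, notMemR ha⟩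
    · have := (notMemR ha).lt_of_ne fun h => hne (ν.injective (by simpa using h.symm))
      simpa using this
    · rw [Equiv.symm_apply_apply]
      have := Pref.not_prefers.mp fun h => I.da_isStable a (ν a) ⟨memR.mp haR, h⟩
      exact this.lt_of_ne hne

/-- Deferred acceptance is optimal for the men among the stable matchings. -/
theorem IsStable.da_weaklyPrefers {I : Market n} {ν : Matching n} (h : I.IsStable ν) (m : Fin n) :
    (I.men m).WeaklyPrefers (I.da m) (ν m) :=
  Pref.not_prefers.mp fun h' =>
    let ⟨m', w, hb, _⟩ := I.exists_blocks_of_prefers_da ν h'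
    h m' w hb

/-- Deferred acceptance is pessimal for the women among the stable matchings. -/
theorem IsStable.weaklyPrefers_da {I : Market n} {ν : Matching n} (h : I.IsStable ν) (w : Fin n) :
    (I.women w).WeaklyPrefers (ν.symm w) (I.da.symm w) := by
  refine Pref.not_prefers.mp fun h' => h (I.da.symm w) w ⟨?_, h'⟩
  have := h.da_weaklyPrefers (I.da.symm w)
  rw [Equiv.apply_symm_apply] at this
  refine this.lt_of_ne fun heq => h'.ne ?_
  rw [Equiv.eq_symm_apply]
  exact heq.symm

/-! ### The manipulation game -/

theorem outcome_isStable (I : Market n) (p : Fin n → Pref n) :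
    (Market.mk p I.women).IsStable (I.outcome p) := da_isStable _

/-- Truthful reporting is a dominant strategy for each man. -/
theorem outcome_weaklyPrefers_update (I : Market n) (p : Fin n → Pref n) (m : Fin n)
    (q : Pref n) :
    (p m).WeaklyPrefers (I.outcome p m) (I.outcome (Function.update p m q) m) := by
  refine Pref.not_prefers.mp fun h => ?_
  -- The blocking man does not gain, so he is not the deviator; his report is unchanged and the pair
  -- blocks the outcome after the deviation.
  obtain ⟨m', w, hb, hm'⟩ := exists_blocks_of_prefers_da (Market.mk p I.women) _ h
  have hne : m' ≠ m := by
    rintro rfl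
    exact not_lt.mpr hm' h
  refine I.outcome_isStable (Function.update p m q) m' w ⟨?_, hb.2⟩
  simpa [Function.update_of_ne hne] using hb.1

/-- Strategy-proofness read backwards: at the profile containing q, the report `p m` is the
misreport. -/
theorem update_outcome_weaklyPrefers (I : Market n) (p : Fin n → Pref n) (m : Fin n)
    (q : Pref n) :
    q.WeaklyPrefers (I.outcome (Function.update p m q) m) (I.outcome p m) := by
  simpa using I.outcome_weaklyPrefers_update (Function.update p m q) m (p m)

theorem nsp_le (I : Market n) (μ : Matching n) : I.nsp μ ≤ n ^ 2 := by
  refine (Finset.card_le_univ _).trans_eq ?_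
  simp [sq]

theorem IsStable.nsp_eq {I : Market n} {μ : Matching n} (h : I.IsStable μ) :
    I.nsp μ = n ^ 2 := by
  rw [nsp, Finset.filter_true_of_mem fun x _ => h x.1 x.2]
  simp [sq]

theorem maxNsp_eq (I : Market n) : I.maxNsp = n ^ 2 := by
  refine IsGreatest.csSup_eq ⟨⟨I.da, I.da_isStable.nsp_eq⟩, ?_⟩
  rintro _ ⟨μ, rfl⟩
  exact I.nsp_le μ

/-! ### Equilibria with a stable outcome -/

/-- Each man reports truthfully about the women whom he reports to be no better than his partner:
whatever he truly prefers to such a woman, he also reports to prefer to her. -/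
def IsTruthfulBelow (I : Market n) (p : Fin n → Pref n) : Prop :=
  ∀ m u v, (p m).WeaklyPrefers (I.outcome p m) v → (I.men m).Prefers u v → (p m).Prefers u v

theorem IsTruthfulBelow.isStable_outcome {I : Market n} {p : Fin n → Pref n}
    (h : I.IsTruthfulBelow p) : I.IsStable (I.outcome p) := fun m w hb =>
  I.outcome_isStable p m w ⟨h m w _ le_rfl hb.1, hb.2⟩

/-- A profitable deviation from a profile that is truthful below its outcome leads to another such
profile, whose outcome is weakly better for all women and strictly better for one. -/
theorem IsTruthfulBelow.exists_improvement {I : Market n} {p : Fin n → Pref n}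
    (h : I.IsTruthfulBelow p) {m w : Fin n} {q : Pref n}
    (hq : I.IsAccompliceManipulation p m w q) :
    ∃ q' : Pref n, I.IsTruthfulBelow (Function.update p m q') ∧
      (∀ v, (I.women v).WeaklyPrefers ((I.outcome (Function.update p m q')).symm v)
        ((I.outcome p).symm v)) ∧
      (I.women w).Prefers ((I.outcome (Function.update p m q')).symm w)
        ((I.outcome p).symm w) := by
  obtain ⟨hw, hm⟩ := hq
  set x := I.outcome p m
  have hkeep : I.outcome (Function.update p m q) m = x := by
    by_contra hne
    -- A truly better wife would also be better under `p m`, against strategy-proofness.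
    have h1 := h m _ _ le_rfl (hm.lt_of_ne hne)
    exact not_lt.mpr (I.outcome_weaklyPrefers_update p m q) h1
  -- Promoting everything that either report puts above x makes the new outcome stable under both `p
  -- m` and q; woman-pessimality then compares it with both old outcomes. The true order elsewhere
  -- preserves truthfulness below x.
  obtain ⟨q', hq'⟩ := (I.men m).exists_promote {v | (p m).Prefers v x ∨ q.Prefers v x}
  have hxU : x ∉ {v | (p m).Prefers v x ∨ q.Prefers v x} := by
    rintro (h | h) <;> exact h.ne rfl
  set p' := Function.update p m q' with hp'
  have hp'm : p' m = q' := Function.update_self _ _ _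
  have hp'ne : ∀ {a}, a ≠ m → p' a = p a := fun ha => Function.update_of_ne ha _ _
  have hupd : ∀ q, Function.update p' m q = Function.update p m q := fun q => by simp [hp']
  have hkeep' : I.outcome p' m = x := by
    by_contra hne
    have h1 : q'.Prefers (I.outcome p' m) x :=
      (I.update_outcome_weaklyPrefers p m q').lt_of_ne hne
    have h2 : ¬ (p m).Prefers (I.outcome p' m) x :=
      Pref.not_prefers.mpr (I.outcome_weaklyPrefers_update p m q')
    have h3 : ¬ q.Prefers (I.outcome p' m) x := by
      have := I.update_outcome_weaklyPrefers p' m q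
      rw [hupd, hkeep] at this
      exact Pref.not_prefers.mpr this
    have h4 : I.outcome p' m ∉ {v | (p m).Prefers v x ∨ q.Prefers v x} := not_or.mpr ⟨h2, h3⟩
    have h5 : (I.men m).Prefers (I.outcome p' m) x := by
      rcases (hq' _ _).mp h1 with h | h
      · exact absurd h.1 h4
      · exact h.2
    exact h2 (h m _ _ le_rfl h5)
  have stable_p : (Market.mk p I.women).IsStable (I.outcome p') := by
    rintro a v ⟨ha, hv⟩
    refine I.outcome_isStable p' a v ⟨?_, hv⟩
    by_cases ham : a = m
    · subst ham
      change (p' a).Prefers v (I.outcome p' a)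
      rw [hp'm, hkeep', hq']
      exact Or.inl ⟨Or.inl (hkeep' ▸ ha), hxU⟩
    · change (p' a).Prefers _ _
      rw [hp'ne ham]
      exact ha
  have stable_q : (Market.mk (Function.update p m q) I.women).IsStable (I.outcome p') := by
    rintro a v ⟨ha, hv⟩
    refine I.outcome_isStable p' a v ⟨?_, hv⟩
    by_cases ham : a = m
    · subst ham
      change (p' a).Prefers v (I.outcome p' a)
      rw [hp'm, hkeep', hq']
      refine Or.inl ⟨Or.inr ?_, hxU⟩
      simpa [hkeep'] using ha
    · change (p' a).Prefers _ _
      rw [hp'ne ham]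
      simpa [Function.update_of_ne ham] using ha
  refine ⟨q', ?_, fun v => stable_p.weaklyPrefers_da v,
    lt_of_le_of_lt (stable_q.weaklyPrefers_da w) hw⟩
  intro a u v hv huv
  by_cases ham : a = m
  · subst ham
    change (p' a).WeaklyPrefers (I.outcome p' a) v at hv
    change (p' a).Prefers u v
    rw [hp'm, hkeep'] at hv
    rw [hp'm, hq']
    have hvU : v ∉ {v | (p a).Prefers v x ∨ q.Prefers v x} := fun hvU =>
      not_lt.mpr hv ((hq' _ _).mpr (Or.inl ⟨hvU, hxU⟩))
    by_cases huU : u ∈ {v | (p a).Prefers v x ∨ q.Prefers v x}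
    · exact Or.inl ⟨huU, hvU⟩
    · exact Or.inr ⟨by simp only [huU, hvU], huv⟩
  · change (p' a).WeaklyPrefers (I.outcome p' a) v at hv
    change (p' a).Prefers u v
    rw [hp'ne ham] at hv ⊢
    -- By man-optimality under p, a's wife gets no better in the new outcome, so v also lies below
    -- his old wife.
    exact h a u v (le_trans (stable_p.da_weaklyPrefers a) hv) huv

/-- Some Nash equilibrium has a stable outcome. -/
theorem exists_isNash_isStable (I : Market n) (P : Finset (Fin n × Fin n)) (A : Finset (Fin n))
    (hA : strategicMen P ⊆ A) : ∃ p, I.IsNash P A p ∧ I.IsStable (I.outcome p) := by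
  -- The potential is the sum of the women's ranks of their husbands; the truthful profile shows
  -- that the set is nonempty.
  obtain ⟨p, ⟨hpA, hp⟩, hmin⟩ := Set.exists_min_image
    {p : Fin n → Pref n | I.IsStrategyProfile A p ∧ I.IsTruthfulBelow p}
    (fun p => ∑ w, ((I.women w).symm ((I.outcome p).symm w) : ℕ)) (Set.toFinite _)
    ⟨I.men, fun _ _ => rfl, fun _ _ _ _ h => h⟩
  refine ⟨p, ⟨hpA, ?_⟩, hp.isStable_outcome⟩
  rintro m w hmw ⟨q, hq⟩
  obtain ⟨q', hq', hle, hlt⟩ := hp.exists_improvement hq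
  have hmA : m ∈ A := hA (Finset.mem_image.mpr ⟨(m, w), hmw, rfl⟩)
  refine not_lt.mpr (hmin (Function.update p m q') ⟨fun a ha => ?_, hq'⟩)
    (Finset.sum_lt_sum (fun v _ => hle v) ⟨w, Finset.mem_univ _, hlt⟩)
  have ham : a ≠ m := by
    rintro rfl
    exact ha hmA
  rw [Function.update_of_ne ham]
  exact hpA a ha

/-! ### Blocking pairs of equilibria -/

/-- In a Nash equilibrium no strategic pair blocks: the man could report the woman as his first
choice. -/
theorem IsNash.not_blocks {I : Market n} {P : Finset (Fin n × Fin n)} {A : Finset (Fin n)}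
    {p : Fin n → Pref n} (h : I.IsNash P A p) {m w : Fin n} (hmw : (m, w) ∈ P) :
    ¬ I.Blocks (I.outcome p) m w := by
  rintro ⟨hm, hw⟩
  obtain ⟨q, hq⟩ := (p m).exists_promote {w}
  have htop : ∀ v, v ≠ w → q.Prefers w v := fun v hv => (hq _ _).mpr (Or.inl ⟨rfl, hv⟩)
  refine h.2 m w hmw ⟨q, ?_, ?_⟩
  · refine lt_of_le_of_lt (Pref.not_prefers.mp fun hlt => ?_) hw
    refine I.outcome_isStable (Function.update p m q) m w ⟨?_, hlt⟩
    change (Function.update p m q m).Prefers _ _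
    rw [Function.update_self]
    refine htop _ fun heq => hlt.ne ?_
    rw [Equiv.eq_symm_apply]
    exact heq
  · by_cases hy : I.outcome (Function.update p m q) m = w
    · rw [hy]
      exact le_of_lt hm
    · by_cases hy' : I.outcome (Function.update p m q) m = I.outcome p m
      · exact le_of_eq (by rw [hy'])
      -- Apart from w, the lists q and `p m` agree, so a third wife would be a `p m`-improvement
      -- obtained by misreporting.
      · rcases (hq _ _).mp ((I.update_outcome_weaklyPrefers p m q).lt_of_ne hy') with h | h
        · exact absurd h.1 hy
        · exact absurd h.2 (Pref.not_prefers.mpr (I.outcome_weaklyPrefers_update p m q))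

theorem IsNash.card_le_nsp {I : Market n} {P : Finset (Fin n × Fin n)} {A : Finset (Fin n)}
    {p : Fin n → Pref n} (h : I.IsNash P A p) : P.card ≤ I.nsp (I.outcome p) :=
  Finset.card_le_card fun _ hx => Finset.mem_filter.mpr ⟨Finset.mem_univ _, h.not_blocks hx⟩

theorem sSup_nsp_nashMatchings (I : Market n) (P : Finset (Fin n × Fin n)) (A : Finset (Fin n))
    (hA : strategicMen P ⊆ A) : sSup (I.nsp '' I.nashMatchings P A) = n ^ 2 := by
  obtain ⟨p, hp, hs⟩ := I.exists_isNash_isStable P A hA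
  refine IsGreatest.csSup_eq ⟨⟨_, ⟨p, hp, rfl⟩, hs.nsp_eq⟩, ?_⟩
  rintro _ ⟨μ, -, rfl⟩
  exact I.nsp_le μ

theorem card_le_sInf_nsp_nashMatchings (I : Market n) (P : Finset (Fin n × Fin n))
    (A : Finset (Fin n)) (hA : strategicMen P ⊆ A) :
    P.card ≤ sInf (I.nsp '' I.nashMatchings P A) := by
  -- An equilibrium is needed here, since the infimum of the empty set of naturals is 0.
  obtain ⟨p, hp, -⟩ := I.exists_isNash_isStable P A hA
  refine le_csInf ⟨_, _, ⟨p, hp, rfl⟩, rfl⟩ ?_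
  rintro _ ⟨_, ⟨p, hp, rfl⟩, rfl⟩
  exact hp.card_le_nsp

/-- If each man reports his partner in `μ` as his first choice, the outcome is `μ`. -/
theorem outcome_eq_of_top (I : Market n) {p : Fin n → Pref n} {μ : Matching n}
    (h : ∀ m v, (p m).WeaklyPrefers (μ m) v) : I.outcome p = μ := by
  have hs : (Market.mk p I.women).IsStable μ := fun m w hb => not_lt.mpr (h m w) hb.1
  exact Equiv.ext fun m => (hs.da_weaklyPrefers m).antisymm (h m _)

end Market

/-! ### The five-by-five instance -/

/-- The outcome of an equilibrium with two blocking pairs. -/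
def fiveMatching : Matching 5 :=
  mkPref ![1, 0, 2, 4, 3] ![1, 0, 2, 4, 3] (by decide) (by decide)

/-- Each man reports his partner in `fiveMatching` as his first choice. -/
def fiveReports (m : Fin 5) : Pref 5 := Equiv.swap 0 (fiveMatching m)

theorem fiveReports_top (m v : Fin 5) : (fiveReports m).WeaklyPrefers (fiveMatching m) v := by
  simp [Pref.WeaklyPrefers, fiveReports]

theorem fiveMarket_outcome : fiveMarket.outcome fiveReports = fiveMatching :=
  fiveMarket.outcome_eq_of_top fiveReports_top

theorem fiveMarket_nsp : fiveMarket.nsp fiveMatching = 23 := by decide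

theorem fivePairs_card : fivePairs.card = 23 := by decide

/-- A couple of `fiveMatching` whose woman has her favourite stays together unless the man
deviates. -/
theorem fiveMarket_outcome_update_of_favourite {m a : Fin 5} (q : Pref 5) (ha : a ≠ m)
    (hfav : ∀ b, (fiveWomen (fiveMatching a)).WeaklyPrefers a b) :
    fiveMarket.outcome (Function.update fiveReports m q) a = fiveMatching a := by
  by_contra hne
  refine fiveMarket.outcome_isStable (Function.update fiveReports m q) a (fiveMatching a)
    ⟨?_, ?_⟩
  · change (Function.update fiveReports m q a).Prefers _ _
    rw [Function.update_of_ne ha]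
    exact (fiveReports_top a _).lt_of_ne (Ne.symm hne)
  · refine Pref.WeaklyPrefers.lt_of_ne (hfav _) fun h => hne ?_
    exact (Equiv.eq_symm_apply _).mp h

/-- The deviator's report is irrelevant if he keeps his partner and no woman likes him better than
her own. -/
theorem fiveMarket_outcome_update_of_unwanted {m : Fin 5} (q : Pref 5)
    (hm : ∀ w, (fiveWomen w).WeaklyPrefers (fiveMatching.symm w) m) (a : Fin 5) (ha : a ≠ m) :
    fiveMarket.outcome (Function.update fiveReports m q) a = fiveMatching a := by
  have hs : (Market.mk (Function.update fiveReports m q) fiveMarket.women).IsStable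
      fiveMatching := by
    rintro b w ⟨hb, hw⟩
    by_cases hbm : b = m
    · subst hbm
      exact not_lt.mpr (hm w) hw
    · change (Function.update fiveReports m q b).Prefers _ _ at hb
      rw [Function.update_of_ne hbm] at hb
      exact not_lt.mpr (fiveReports_top b w) hb
  have h := hs.da_weaklyPrefers a
  change (Function.update fiveReports m q a).WeaklyPrefers _ _ at h
  rw [Function.update_of_ne ha] at h
  exact h.antisymm (fiveReports_top a _)

theorem fiveMarket_isNash :
    fiveMarket.IsNash fivePairs (Market.strategicMen fivePairs) fiveReports := by
  refine ⟨fun m hm => absurd ((by decide : ∀ m, m ∈ Market.strategicMen fivePairs) m) hm, ?_⟩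
  rintro m w hmw ⟨q, hw, hm⟩
  rw [fiveMarket_outcome] at hw hm
  set ν := fiveMarket.outcome (Function.update fiveReports m q)
  have hfav : ∀ a, a ≠ m → (∀ b, (fiveWomen (fiveMatching a)).WeaklyPrefers a b) →
      ν a = fiveMatching a := fun a ha =>
    fiveMarket_outcome_update_of_favourite q ha
  by_cases hm2 : m = 2
  · subst hm2
    -- The third man's strategic pairs involve only women who already have their favourite.
    have hbest : ∀ w, ((2, w) : Fin 5 × Fin 5) ∈ fivePairs →
        ∀ b, ¬ (fiveWomen w).Prefers b (fiveMatching.symm w) := by decide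
    exact hbest w hmw _ hw
  · have hagree : ∃ b, ∀ a, a ≠ b → ν a = fiveMatching a := by
      by_cases hunw : ∀ w, (fiveWomen w).WeaklyPrefers (fiveMatching.symm w) m
      · exact ⟨m, fiveMarket_outcome_update_of_unwanted q hunw⟩
      -- Only the first two men remain. Each already has his true favourite and must keep her, while
      -- the last three couples are held together by their women; one couple is left.
      · have hcases : ∀ m, m ≠ 2 →
            (¬ ∀ w, (fiveWomen w).WeaklyPrefers (fiveMatching.symm w) m) →
            (∀ v, (fiveMen m).WeaklyPrefers v (fiveMatching m) → v = fiveMatching m) ∧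
              ∃ b, ∀ a, a ≠ b → a = m ∨
                a ≠ m ∧ ∀ c, (fiveWomen (fiveMatching a)).WeaklyPrefers a c := by decide
        obtain ⟨htop, b, hb⟩ := hcases m hm2 hunw
        refine ⟨b, fun a ha => ?_⟩
        rcases hb a ha with rfl | ⟨ham, hf⟩
        · exact htop _ hm
        · exact hfav a ham hf
    obtain ⟨b, hb⟩ := hagree
    -- Two bijections that agree off one point agree there too.
    have hνb : ν b = fiveMatching b := by
      have hfix : fiveMatching.symm (ν b) = b := by
        by_contra hne
        have := hb _ hne
        rw [Equiv.apply_symm_apply] at this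
        exact hne (ν.injective this)
      rw [← hfix, Equiv.apply_symm_apply, hfix]
    have : ν = fiveMatching := Equiv.ext fun a => by
      by_cases ha : a = b
      · rw [ha, hνb]
      · exact hb a ha
    rw [this] at hw
    exact hw.ne rfl

theorem fiveMarket_sInf_nsp :
    sInf (fiveMarket.nsp '' fiveMarket.nashMatchings fivePairs
      (Market.strategicMen fivePairs)) = 23 := by
  refine le_antisymm (Nat.sInf_le ⟨_, ⟨_, fiveMarket_isNash, fiveMarket_outcome⟩,
    fiveMarket_nsp⟩) ?_
  rw [← fivePairs_card]
  exact fiveMarket.card_le_sInf_nsp_nashMatchings _ _ subset_rfl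

end StableMarriage

theorem mainTheorem6 :
    (∀ (n : ℕ), 1 ≤ n →
      ∀ (I : StableMarriage.Market n) (P : Finset (Fin n × Fin n)) (A : Finset (Fin n)),
        StableMarriage.Market.strategicMen P ⊆ A →
          (I.nashMatchings P A).Nonempty ∧
          I.maxNsp = n ^ 2 ∧
          I.priceOfStability P A = 1 ∧
          (P.Nonempty → I.priceOfAnarchy P A ≤ (n : ℚ) ^ 2 / (P.card : ℚ))) ∧
    StableMarriage.fiveMarket.priceOfAnarchy StableMarriage.fivePairs
        (StableMarriage.Market.strategicMen StableMarriage.fivePairs)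
      = (5 : ℚ) ^ 2 / (StableMarriage.fivePairs.card : ℚ) := by 
  refine ⟨fun n hn I P A hA => ⟨?_, I.maxNsp_eq, ?_, fun hP => ?_⟩, ?_⟩
  · obtain ⟨p, hp, -⟩ := I.exists_isNash_isStable P A hA
    exact ⟨_, p, hp, rfl⟩
  · rw [StableMarriage.Market.priceOfStability, I.maxNsp_eq, I.sSup_nsp_nashMatchings P A hA]
    -- For n = 0 the ratio would be 0 / 0 = 0, so n ≥ 1 matters.
    exact div_self (by positivity)
  · rw [StableMarriage.Market.priceOfAnarchy, I.maxNsp_eq, Nat.cast_pow]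
    have hpos : (0 : ℚ) < P.card := by exact_mod_cast hP.card_pos
    have hle : (P.card : ℚ) ≤ (sInf (I.nsp '' I.nashMatchings P A) : ℕ) := by
      exact_mod_cast I.card_le_sInf_nsp_nashMatchings P A hA
    exact div_le_div_of_nonneg_left (by positivity) hpos hle
  · rw [StableMarriage.Market.priceOfAnarchy, StableMarriage.Market.maxNsp_eq,
      StableMarriage.fiveMarket_sInf_nsp, StableMarriage.fivePairs_card]
    norm_num
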